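/- Let $X,Y,Z$ be discrete random variables whose joint distribution is compatible with the classical triangle causal structure, i.e. there are three independent discrete random variables $A,B,C$, with distributions $P_A,P_B,P_C$, and conditional distributions $P_{X|BC},P_{Y|AC},P_{Z|AB}$ such that $$P_{XYZ}=\sum_{A,B,C}P_A\,P_B\,P_C\,P_{X|BC}\,P_{Y|AC}\,P_{Z|AB},$$ and suppose that the Shannon entropies (in bits) $H(X),H(Y),H(Z),H(XY),H(XZ),H(YZ),H(XYZ)$ of $X,Y,Z$ are finite. Then for every integer $s\ge 1$ the following three inequalities hold: $$\left(-\tfrac12 s^2-\tfrac32 s\right)\bigl(H(X)+H(Z)\bigr)-(s+1)H(Y)+\left(\tfrac12 s^2+\tfrac32 s+1\right)\bigl(H(XY)+H(YZ)\bigr)+s(s+2)H(XZ)-(s+1)^2H(XYZ)\ge 0,$$ $$\left(-\tfrac12 s^2-\tfrac32 s-2\right)\bigl(H(X)+H(Y)+H(Z)-H(XY)\bigr)+\left(\tfrac12 s^2+\tfrac32 s+1\right)H(XZ)+(s+2)H(YZ)-(s+1)H(XYZ)\ge 0,$$ $$\left(-\tfrac12 s^2-\tfrac32 s-2\right)\bigl(H(X)+H(Z)-H(XY)\bigr)-(2s+2)H(Y)+(s^2+2)H(XZ)+\left(\tfrac12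 s^2+\tfrac32 s+1\right)H(YZ)-(s^2+1)H(XYZ)\ge 0.$$ The same holds for all permutations of $X$, $Y$ and $Z$ in these inequalities. -/

import Mathlib

open scoped ENNReal

/-- The discrete distribution `p` has finite Shannon entropy `h` (base-two logarithm, with
`0 * log 0 = 0`): the sum `- ∑ₐ p(a) log₂ p(a)` converges and equals `h`.
The alphabet is arbitrary; a `PMF` has countable support. -/
def HasShannonEntropy {α : Type} (p : PMF α) (h : ℝ) : Prop :=
  HasSum (fun a : α => -((p a).toReal * Real.logb 2 (p a).toReal)) h

/-- The marginal, on the variables in `S`, of a joint distribution of three variables. -/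
noncomputable def marginal {E : Fin 3 → Type} (P : PMF (∀ i, E i)) (S : Finset (Fin 3)) :
    PMF (∀ i : S, E i) :=
  P.map S.restrict

/-- Vectors in `ℝ⁷`, with one component for each nonempty subset of the three variables. -/
abbrev EntropySpace : Type :=
  {S : Finset (Fin 3) // S.Nonempty} → ℝ

/-- The component `H(S)` of a vector, with the convention `H(∅) = 0`. -/
noncomputable def EntropySpace.H (v : EntropySpace) (S : Finset (Fin 3)) : ℝ :=
  if hS : S.Nonempty then v ⟨S, hS⟩ else 0

/-- `v` is the entropy vector of the joint distribution `P`: every component of `v` is the (finite)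
Shannon entropy of the corresponding marginal. -/
def IsEntropyVector {E : Fin 3 → Type} (P : PMF (∀ i, E i)) (v : EntropySpace) : Prop :=
  ∀ S : {S : Finset (Fin 3) // S.Nonempty}, HasShannonEntropy (marginal P S) (v S)

/-- The observed distributions compatible with the classical triangle: the observed variables
are `X = 0`, `Y = 1`, `Z = 2`, with alphabets `E 0`, `E 1`, `E 2`; the unobserved sources `A`, `B`,
`C` are independent, and
`P_{XYZ} = ∑_{A,B,C} P_A P_B P_C P_{X|BC} P_{Y|AC} P_{Z|AB}`. -/
def triangleDistributions (E : Fin 3 → Type) : Set (PMF (∀ i, E i)) :=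
  {P | ∃ (A B C : Type) (pA : PMF A) (pB : PMF B) (pC : PMF C)
      (pX : B → C → PMF (E 0)) (pY : A → C → PMF (E 1)) (pZ : A → B → PMF (E 2)),
      ∀ x : ∀ i, E i,
        P x = ∑' (a : A) (b : B) (c : C),
          pA a * pB b * pC c * pX b c (x 0) * pY a c (x 1) * pZ a b (x 2)}

/-- The set of all entropy vectors of observed distributions that are compatible with the
classical triangle. -/
def triangleEntropyVectors : Set EntropySpace :=
  {v | ∃ (E : Fin 3 → Type) (P : PMF (∀ i, E i)),
      P ∈ triangleDistributions E ∧ IsEntropyVector P v}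

/-! On a finite probability space, variables are partitions, joint variables are infima, and every
Shannon inequality is an instance of `cmi_nonneg`. The inequalities come from two families of Matúš
in five variables (`matusFirst_nonneg`, `matusSecond_nonneg_and`), which bound how far the Ingleton
inequality can fail. Both are proved by induction on `s`. The variable `e` occurs only together with
one fixed pair of the others, so it may be replaced by a copy that is conditionally independent of
everything else given that pair (`exists_copy`). This independence turns the case `s` into the case
`s + 1`.

In the triangle, two observed variables are independent given the source they share, and the third
is independent of that source (`cmi_observed`, `cmi_source`). With that source as one of the five
variables, the Ingleton expression loses two of its terms and involves only observed variables. For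
the first inequality the source then disappears altogether. For the other two, mutual informations
with the source remain, and `cmi_le` and `cmi_add_le` bound them by observed entropies.

Infinite alphabets and sources are handled by truncation. The finite models have laws dominated by
multiples, tending to one, of the given law, so their entropies converge by dominated convergence,
and non-strict linear inequalities survive the limit. -/

lemma Setoid.inf_rel {α : Type*} (r s : Setoid α) (x y : α) :
    (r ⊓ s) x y ↔ r x y ∧ s x y := Iff.rfl

/-- The probability of the class of `ω` under the equivalence relation `r`. -/
noncomputable def classMass {Ω : Type} [Fintype Ω] (p : Ω → ℝ) (r : Setoid Ω) (ω : Ω) : ℝ := by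
  classical exact ∑ ω', if r ω ω' then p ω' else 0

/-- The Shannon entropy (in nats) of the partition of a finite probability space into the classes
of `r`. The join of two partitions is the infimum of the relations. -/
noncomputable def ent {Ω : Type} [Fintype Ω] (p : Ω → ℝ) (r : Setoid Ω) : ℝ :=
  -∑ ω, p ω * Real.log (classMass p r ω)

/-- The conditional mutual information `I(x; y | z)` of partitions. -/
noncomputable def cmi {Ω : Type} [Fintype Ω] (p : Ω → ℝ) (x y z : Setoid Ω) : ℝ :=
  ent p (x ⊓ z) + ent p (y ⊓ z) - ent p (x ⊓ y ⊓ z) - ent p z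

/-! ### Shannon inequalities for partitions of a finite probability space. -/

section Entropy

variable {Ω : Type} [Fintype Ω] {p : Ω → ℝ}

open scoped Classical in
lemma classMass_def (p : Ω → ℝ) (r : Setoid Ω) (ω : Ω) :
    classMass p r ω = ∑ ω', if r ω ω' then p ω' else 0 := by
  unfold classMass; congr!

lemma le_classMass (hp : p ∈ stdSimplex ℝ Ω) (r : Setoid Ω) (ω : Ω) : p ω ≤ classMass p r ω := by
  classical
  rw [classMass_def]
  have := Finset.single_le_sum (f := fun ω' => if r ω ω' then p ω' else 0)
    (fun i _ => by split_ifs <;> [exact hp.1 i; exact le_rfl]) (Finset.mem_univ ω)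
  simpa [r.refl ω] using this

lemma classMass_nonneg (hp : p ∈ stdSimplex ℝ Ω) (r : Setoid Ω) (ω : Ω) : 0 ≤ classMass p r ω :=
  (hp.1 ω).trans (le_classMass hp r ω)

lemma classMass_pos (hp : p ∈ stdSimplex ℝ Ω) (r : Setoid Ω) {ω : Ω} (h : p ω ≠ 0) :
    0 < classMass p r ω :=
  ((hp.1 ω).lt_of_ne' h).trans_le (le_classMass hp r ω)

lemma classMass_congr (p : Ω → ℝ) {r : Setoid Ω} {ω ω' : Ω} (h : r ω ω') :
    classMass p r ω = classMass p r ω' := by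
  classical
  rw [classMass_def, classMass_def]
  refine Finset.sum_congr rfl fun i _ => ?_
  have : r ω i ↔ r ω' i := ⟨fun h' => r.trans (r.symm h) h', fun h' => r.trans h h'⟩
  simp [this]

lemma ent_top (hp : p ∈ stdSimplex ℝ Ω) : ent p ⊤ = 0 := by
  classical
  have : ∀ ω, classMass p ⊤ ω = 1 := fun ω => by
    rw [classMass_def, ← hp.2]; exact Finset.sum_congr rfl fun i _ => if_pos trivial
  simp [ent, this]

/-- Summing `p ω / P(class of ω)` over a subset of one class gives at most one. -/
lemma sum_div_classMass_le_one (hp : p ∈ stdSimplex ℝ Ω) (r : Setoid Ω) (Q : Ω → Prop)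
    [DecidablePred Q] (hQ : ∀ i j, Q i → Q j → r i j) :
    ∑ ω, (if Q ω then p ω / classMass p r ω else 0) ≤ 1 := by
  classical
  by_cases h : ∃ i, Q i
  · obtain ⟨i, hi⟩ := h
    calc ∑ ω, (if Q ω then p ω / classMass p r ω else 0)
        ≤ ∑ ω, (if r i ω then p ω else 0) / classMass p r i := by
          refine Finset.sum_le_sum fun j _ => ?_
          by_cases hj : Q j
          · rw [if_pos hj, if_pos (hQ i j hi hj), classMass_congr p (hQ i j hi hj)]
          · rw [if_neg hj]
            refine div_nonneg ?_ (classMass_nonneg hp r i)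
            split_ifs <;> [exact hp.1 j; exact le_rfl]
      _ = classMass p r i / classMass p r i := by rw [← Finset.sum_div, classMass_def]
      _ ≤ 1 := div_self_le_one _
  · push Not at h
    simp [h]

/-- Expand the numerator as a sum over pairs `i`, `j` and sum over `ω` first. For fixed `i` and `j`,
the admissible `ω` lie in a single class of `x ⊓ y ⊓ z`, so they contribute at most one. What
remains is `i` weighted by `p` and `j` by `p` conditioned on the `z`-class of `i`. With `log t ≤ t -
1` this gives submodularity. -/
lemma sum_ratio_le_one (hp : p ∈ stdSimplex ℝ Ω) (x y z : Setoid Ω) :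
    ∑ ω, p ω * (classMass p (x ⊓ z) ω * classMass p (y ⊓ z) ω /
      (classMass p (x ⊓ y ⊓ z) ω * classMass p z ω)) ≤ 1 := by
  classical
  have e1 : ∀ ω, p ω * (classMass p (x ⊓ z) ω * classMass p (y ⊓ z) ω /
      (classMass p (x ⊓ y ⊓ z) ω * classMass p z ω)) =
      ∑ i, ∑ j, (p i * (if z i j then p j / classMass p z i else 0)) *
        (if x ω i ∧ z ω i ∧ y ω j ∧ z ω j then p ω / classMass p (x ⊓ y ⊓ z) ω else 0) := by
    intro ω
    rw [classMass_def p (x ⊓ z), classMass_def p (y ⊓ z), Finset.sum_mul_sum, Finset.sum_div,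
      Finset.mul_sum]
    refine Finset.sum_congr rfl fun i _ => ?_
    rw [Finset.sum_div, Finset.mul_sum]
    refine Finset.sum_congr rfl fun j _ => ?_
    by_cases h1 : (x ⊓ z) ω i
    · by_cases h2 : (y ⊓ z) ω j
      · obtain ⟨h1x, h1z⟩ := (Setoid.inf_rel x z ω i).1 h1
        obtain ⟨h2y, h2z⟩ := (Setoid.inf_rel y z ω j).1 h2
        have h3 : z i j := z.trans (z.symm h1z) h2z
        rw [if_pos h1, if_pos h2, if_pos h3, if_pos ⟨h1x, h1z, h2y, h2z⟩, classMass_congr p h1z]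
        ring
      · have h2' : ¬ (x ω i ∧ z ω i ∧ y ω j ∧ z ω j) := fun h => h2 h.2.2
        rw [if_neg h2, if_neg h2']; simp
    · have h1' : ¬ (x ω i ∧ z ω i ∧ y ω j ∧ z ω j) := fun h => h1 ⟨h.1, h.2.1⟩
      rw [if_neg h1, if_neg h1']; simp
  rw [Finset.sum_congr rfl fun ω _ => e1 ω, Finset.sum_comm]
  have e2 : ∀ i, ∑ ω, ∑ j, (p i * (if z i j then p j / classMass p z i else 0)) *
        (if x ω i ∧ z ω i ∧ y ω j ∧ z ω j then p ω / classMass p (x ⊓ y ⊓ z) ω else 0) ≤ p i := by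
    intro i
    rw [Finset.sum_comm]
    calc _ ≤ ∑ j, (p i * (if z i j then p j / classMass p z i else 0)) * 1 := by
          refine Finset.sum_le_sum fun j _ => ?_
          rw [← Finset.mul_sum]
          refine mul_le_mul_of_nonneg_left ?_ (mul_nonneg (hp.1 i) ?_)
          · refine sum_div_classMass_le_one hp _ _ fun k l hk hl => ?_
            exact ⟨⟨x.trans hk.1 (x.symm hl.1), y.trans hk.2.2.1 (y.symm hl.2.2.1)⟩,
              z.trans hk.2.1 (z.symm hl.2.1)⟩
          · split_ifs <;> [exact div_nonneg (hp.1 j) (classMass_nonneg hp z i); exact le_rfl]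
      _ ≤ p i * 1 := by
          simp only [mul_one]
          rw [← Finset.mul_sum]
          refine mul_le_of_le_one_right (hp.1 i) ?_
          have : ∑ j, (if z i j then p j / classMass p z i else 0) =
              classMass p z i / classMass p z i := by
            conv_rhs => rw [classMass_def p z i]
            rw [Finset.sum_div]
            refine Finset.sum_congr rfl fun j _ => ?_
            split_ifs <;> simp [classMass_def]
          rw [this]
          exact div_self_le_one _
      _ = p i := mul_one _
  calc _ ≤ ∑ i, p i := Finset.sum_le_sum fun i _ => e2 i
    _ = 1 := hp.2

/-- Submodularity of entropy. -/
theorem cmi_nonneg (hp : p ∈ stdSimplex ℝ Ω) (x y z : Setoid Ω) : 0 ≤ cmi p x y z := by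
  have key : ∀ ω, p ω * Real.log (classMass p (x ⊓ z) ω) +
      p ω * Real.log (classMass p (y ⊓ z) ω) - p ω * Real.log (classMass p (x ⊓ y ⊓ z) ω) -
      p ω * Real.log (classMass p z ω) ≤
      p ω * (classMass p (x ⊓ z) ω * classMass p (y ⊓ z) ω /
      (classMass p (x ⊓ y ⊓ z) ω * classMass p z ω)) - p ω := by
    intro ω
    by_cases h : p ω = 0
    · simp [h]
    have h1 := classMass_pos hp (x ⊓ z) h
    have h2 := classMass_pos hp (y ⊓ z) h
    have h3 := classMass_pos hp (x ⊓ y ⊓ z) h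
    have h4 := classMass_pos hp z h
    have := Real.log_le_sub_one_of_pos (div_pos (mul_pos h1 h2) (mul_pos h3 h4))
    rw [Real.log_div (by positivity) (by positivity), Real.log_mul h1.ne' h2.ne',
      Real.log_mul h3.ne' h4.ne'] at this
    nlinarith [mul_le_mul_of_nonneg_left this (hp.1 ω)]
  have h := Finset.sum_le_sum fun ω (_ : ω ∈ Finset.univ) => key ω
  simp only [Finset.sum_sub_distrib, Finset.sum_add_distrib] at h
  have := sum_ratio_le_one hp x y z
  have h1 := hp.2
  unfold cmi ent
  linarith

theorem cmi_eq_zero (hp : p ∈ stdSimplex ℝ Ω) {x y z : Setoid Ω}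
    (h : ∀ ω, p ω ≠ 0 → classMass p (x ⊓ y ⊓ z) ω * classMass p z ω =
      classMass p (x ⊓ z) ω * classMass p (y ⊓ z) ω) : cmi p x y z = 0 := by
  have key : ∀ ω, p ω * Real.log (classMass p (x ⊓ z) ω) +
      p ω * Real.log (classMass p (y ⊓ z) ω) = p ω * Real.log (classMass p (x ⊓ y ⊓ z) ω) +
      p ω * Real.log (classMass p z ω) := by
    intro ω
    by_cases h0 : p ω = 0
    · simp [h0]
    have := congrArg Real.log (h ω h0)
    rw [Real.log_mul (classMass_pos hp _ h0).ne' (classMass_pos hp _ h0).ne',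
      Real.log_mul (classMass_pos hp _ h0).ne' (classMass_pos hp _ h0).ne'] at this
    rw [← mul_add, ← mul_add, this]
  have h := Finset.sum_congr rfl fun ω (_ : ω ∈ Finset.univ) => key ω
  simp only [Finset.sum_add_distrib] at h
  unfold cmi ent
  linarith

/-- Entropy only depends on the relation on the support. -/
lemma ent_congr {r r' : Setoid Ω} (h : ∀ ω ω', p ω ≠ 0 → p ω' ≠ 0 → (r ω ω' ↔ r' ω ω')) :
    ent p r = ent p r' := by
  classical
  unfold ent
  congr 1
  refine Finset.sum_congr rfl fun ω _ => ?_
  by_cases h0 : p ω = 0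
  · simp [h0]
  rw [classMass_def, classMass_def]
  congr 2
  refine Finset.sum_congr rfl fun ω' _ => ?_
  by_cases h1 : p ω' = 0
  · simp [h1]
  simp [h ω ω' h0 h1]

/-- Entropy of a pulled-back partition. -/
lemma ent_comap {Ω' : Type} [Fintype Ω'] [DecidableEq Ω] {p' : Ω' → ℝ} (g : Ω' → Ω)
    (hg : ∀ ω, ∑ ω', (if g ω' = ω then p' ω' else 0) = p ω) (r : Setoid Ω) :
    ent p' (r.comap g) = ent p r := by
  classical
  have key : ∀ F : Ω → ℝ, ∑ ω', p' ω' * F (g ω') = ∑ ω, p ω * F ω := by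
    intro F
    simp_rw [← hg, Finset.sum_mul]
    rw [Finset.sum_comm]
    refine Finset.sum_congr rfl fun ω' _ => ?_
    simp [ite_mul]
  have mass : ∀ ω', classMass p' (r.comap g) ω' = classMass p r (g ω') := by
    intro ω'
    rw [classMass_def, classMass_def]
    have := key fun i => if r (g ω') i then 1 else 0
    simpa [Setoid.comap_rel] using this
  simp only [ent, mass]
  rw [key fun ω => Real.log (classMass p r ω)]

lemma cmi_comap {Ω' : Type} [Fintype Ω'] [DecidableEq Ω] {p' : Ω' → ℝ} (g : Ω' → Ω)
    (hg : ∀ ω, ∑ ω', (if g ω' = ω then p' ω' else 0) = p ω) (x y z : Setoid Ω) :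
    cmi p' (x.comap g) (y.comap g) (z.comap g) = cmi p x y z := by
  have h : ∀ r r' : Setoid Ω, r.comap g ⊓ r'.comap g = (r ⊓ r').comap g := fun _ _ => rfl
  simp only [cmi, h, ent_comap g hg]

end Entropy

/-! ### Adding variables by kernels, and conditionally independent copies. -/

section Extension

variable {Ω Z : Type} [Fintype Ω] [Fintype Z] {p : Ω → ℝ} {k : Ω → Z → ℝ}

/-- The weights on `Ω × Z` obtained by generating `Z` from `Ω` by the kernel `k`. -/
noncomputable def extend (p : Ω → ℝ) (k : Ω → Z → ℝ) (w : Ω × Z) : ℝ := p w.1 * k w.1 w.2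

lemma extend_mem_stdSimplex (hp : p ∈ stdSimplex ℝ Ω) (hk : ∀ ω, k ω ∈ stdSimplex ℝ Z) :
    extend p k ∈ stdSimplex ℝ (Ω × Z) := by
  refine ⟨fun w => mul_nonneg (hp.1 _) ((hk _).1 _), ?_⟩
  simp only [extend, Fintype.sum_prod_type, ← Finset.mul_sum, (hk _).2, mul_one, hp.2]

lemma sum_extend_fst [DecidableEq Ω] (p : Ω → ℝ) (hk : ∀ ω, k ω ∈ stdSimplex ℝ Z) (ω : Ω) :
    ∑ w : Ω × Z, (if w.1 = ω then extend p k w else 0) = p ω := by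
  rw [Fintype.sum_prod_type, Finset.sum_eq_single ω]
  · simp [extend, ← Finset.mul_sum, (hk _).2]
  · intro b _ hb; simp [hb]
  · simp

/-- A variable generated from the class of `t` by a kernel is independent of everything else
given that class. -/
lemma cmi_extend (hp : p ∈ stdSimplex ℝ Ω) (hk : ∀ ω, k ω ∈ stdSimplex ℝ Z) (t : Setoid Ω)
    (ht : ∀ ω ω', t ω ω' → k ω = k ω') (x : Setoid Ω) (y : Setoid Z) :
    cmi (extend p k) (x.comap Prod.fst) (y.comap Prod.snd)
      (t.comap Prod.fst) = 0 := by
  classical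
  have h1 : ∀ (r : Setoid Ω), r ≤ t → ∀ w : Ω × Z,
      classMass (extend p k) (r.comap Prod.fst ⊓ y.comap Prod.snd) w =
      classMass p r w.1 * classMass (k w.1) y w.2 := by
    intro r hr w
    rw [classMass_def, classMass_def, classMass_def, Fintype.sum_prod_type, Finset.sum_mul_sum]
    refine Finset.sum_congr rfl fun i _ => Finset.sum_congr rfl fun j _ => ?_
    simp only [Setoid.inf_rel, Setoid.comap_rel, extend]
    by_cases h : r w.1 i
    · rw [ht _ _ (hr h)]
      by_cases h' : y w.2 j <;> simp [h, h']
    · simp [h]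
  have h2 : ∀ (r : Setoid Ω) (w : Ω × Z),
      classMass (extend p k) (r.comap Prod.fst) w = classMass p r w.1 := by
    intro r w
    rw [classMass_def, classMass_def, Fintype.sum_prod_type]
    refine Finset.sum_congr rfl fun i _ => ?_
    simp only [Setoid.comap_rel, extend]
    by_cases h : r w.1 i
    · simp [h, ← Finset.mul_sum, (hk i).2]
    · simp [h]
  refine cmi_eq_zero (extend_mem_stdSimplex hp hk) fun w _ => ?_
  have e1 : x.comap (Prod.fst : Ω × Z → Ω) ⊓ y.comap Prod.snd ⊓ t.comap Prod.fst =
      (x ⊓ t).comap Prod.fst ⊓ y.comap Prod.snd := by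
    rw [inf_right_comm]; rfl
  have e2 : x.comap (Prod.fst : Ω × Z → Ω) ⊓ t.comap Prod.fst = (x ⊓ t).comap Prod.fst := rfl
  rw [e1, e2, inf_comm (y.comap _), h1 _ inf_le_right, h1 _ le_rfl, h2, h2]
  ring

end Extension

/-- Adhesive extension: every partition `y` has a copy over `s` that is independent of the old
partitions given `s`. -/
theorem exists_copy {Ω : Type} [Fintype Ω] {p : Ω → ℝ} (hp : p ∈ stdSimplex ℝ Ω)
    (s y : Setoid Ω) :
    ∃ (Ω' : Type) (_ : Fintype Ω') (p' : Ω' → ℝ) (g : Ω' → Ω) (y' : Setoid Ω'),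
      p' ∈ stdSimplex ℝ Ω' ∧ (∀ r : Setoid Ω, ent p' (r.comap g) = ent p r) ∧
      (∀ t, s ≤ t → ent p' (y' ⊓ t.comap g) = ent p (y ⊓ t)) ∧
      ∀ x : Setoid Ω, cmi p' (x.comap g) y' (s.comap g) = 0 := by
  classical
  -- The second coordinate is drawn from `p` conditioned on the `s`-class of the first. On classes
  -- of mass zero, `p` itself is an arbitrary choice that keeps `k ω` a probability vector.
  let k : Ω → Ω → ℝ := fun ω ω' =>
    if classMass p s ω = 0 then p ω' else if s ω ω' then p ω' / classMass p s ω else 0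
  have hk : ∀ ω, k ω ∈ stdSimplex ℝ Ω := by
    intro ω
    by_cases h : classMass p s ω = 0
    · have : k ω = p := by funext; simp [k, h]
      rwa [this]
    · refine ⟨fun ω' => ?_, ?_⟩
      · simp only [k, if_neg h]
        split_ifs <;> [exact div_nonneg (hp.1 _) (classMass_nonneg hp _ _); exact le_rfl]
      · simp only [k, if_neg h]
        have : ∀ i, (if s ω i then p i / classMass p s ω else 0) =
            (if s ω i then p i else 0) / classMass p s ω := fun i => by split_ifs <;> simp
        rw [Finset.sum_congr rfl fun i _ => this i, ← Finset.sum_div, ← classMass_def, div_self h]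
  have hks : ∀ ω ω', s ω ω' → k ω = k ω' := by
    intro ω ω' h
    funext i
    have : s ω i ↔ s ω' i := ⟨fun h' => s.trans (s.symm h) h', fun h' => s.trans h h'⟩
    simp only [k, classMass_congr p h, this]
  have hsnd : ∀ ω, ∑ w : Ω × Ω, (if w.2 = ω then extend p k w else 0) = p ω := by
    intro ω
    rw [Fintype.sum_prod_type_right, Finset.sum_eq_single ω]
    · simp only [if_true, extend]
      by_cases h0 : p ω = 0
      · refine (Finset.sum_eq_zero fun i _ => ?_).trans h0.symm
        simp [k, h0]
      have hm := classMass_pos hp s h0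
      calc ∑ i, p i * k i ω = ∑ i, (if s ω i then p i else 0) * (p ω / classMass p s ω) := by
            refine Finset.sum_congr rfl fun i _ => ?_
            by_cases h : s ω i
            · have := classMass_congr p h
              simp [k, h, s.symm h, ← this, hm.ne']
            · have h' : ¬ s i ω := fun h' => h (s.symm h')
              by_cases hi : p i = 0
              · simp [hi, h]
              · simp [k, h, h', (classMass_pos hp s hi).ne']
        _ = p ω := by
            rw [← Finset.sum_mul, ← classMass_def, mul_div_cancel₀ _ hm.ne']
    · intro b _ hb; simp [hb]
    · simp
  refine ⟨Ω × Ω, inferInstance, extend p k, Prod.fst, y.comap Prod.snd,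
    extend_mem_stdSimplex hp hk, fun r => ent_comap _ (sum_extend_fst p hk) r, ?_,
    fun x => cmi_extend hp hk s hks x y⟩
  intro t ht
  rw [← ent_comap Prod.snd hsnd (y ⊓ t)]
  -- Almost surely the two coordinates share their `s`-class, hence their `t`-class, so `t` may be
  -- read off either one. The joint entropy of the copy with `t` is then computed on the second
  -- marginal, which is `p`.
  have supp : ∀ w : Ω × Ω, p w.1 * k w.1 w.2 ≠ 0 → t w.1 w.2 := by
    intro w hw
    by_contra h
    have h' : ¬ s w.1 w.2 := fun h' => h (ht h')
    have := (classMass_pos hp s (left_ne_zero_of_mul hw)).ne'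
    simp [k, h', this] at hw
  refine ent_congr fun w w' hw hw' => ?_
  simp only [Setoid.inf_rel, Setoid.comap_rel]
  refine and_congr_right fun _ => ⟨fun h => ?_, fun h => ?_⟩
  · exact t.trans (t.symm (supp w hw)) (t.trans h (supp w' hw'))
  · exact t.trans (supp w hw) (t.trans h (t.symm (supp w' hw')))

/-! ### The Matúš inequalities. -/

section Matus

variable {Ω : Type} [Fintype Ω]

/-- The Ingleton expression `I(a;b|c) + I(a;b|d) + I(c;d) - I(a;b)`. -/
noncomputable def ingleton (p : Ω → ℝ) (a b c d : Setoid Ω) : ℝ :=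
  cmi p a b c + cmi p a b d + cmi p c d ⊤ - cmi p a b ⊤

/-- The five-variable form of the first Matúš family. -/
noncomputable def matusFirst (p : Ω → ℝ) (s : ℝ) (a b c d e : Setoid Ω) : ℝ :=
  s * ingleton p a b c d + cmi p a b e + s * (cmi p a e b + cmi p b e a) +
    s * (s - 1) / 2 * (cmi p a c b + cmi p b c a)

/-- The five-variable form of the second Matúš family. -/
noncomputable def matusSecond (p : Ω → ℝ) (s : ℝ) (a b c d e : Setoid Ω) : ℝ :=
  s * ingleton p a b c d + cmi p a e b + s * (cmi p a b e + cmi p b e a) +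
    s * (s - 1) / 2 * (cmi p a b c + cmi p b c a)

/-- A companion of `matusSecond`, needed for its inductive proof. -/
noncomputable def matusCompanion (p : Ω → ℝ) (s : ℝ) (a b c d e : Setoid Ω) : ℝ :=
  s * ingleton p a b c d + cmi p e c b + s * (cmi p e b c + cmi p b c e) +
    s * (s - 1) / 2 * (cmi p a b c + cmi p b c a)

variable {p : Ω → ℝ}

/-- The chain rule, in either order, splits the vanishing quantity into two nonnegative terms. -/
lemma cmi_inf_eq_zero (hp : p ∈ stdSimplex ℝ Ω) {c d f t : Setoid Ω}
    (h : cmi p (c ⊓ d) f t = 0) :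
    cmi p c f t = 0 ∧ cmi p d f t = 0 ∧ cmi p c f (d ⊓ t) = 0 ∧ cmi p d f (c ⊓ t) = 0 := by
  have h1 := cmi_nonneg hp c f t
  have h2 := cmi_nonneg hp d f t
  have h3 := cmi_nonneg hp c f (d ⊓ t)
  have h4 := cmi_nonneg hp d f (c ⊓ t)
  simp only [cmi, inf_comm, inf_left_comm] at h h1 h2 h3 h4 ⊢
  refine ⟨?_, ?_, ?_, ?_⟩ <;> linarith

/-- By the chain rule and `I(c;f|ab) = 0`, `I(a;cf|b) = I(a;c|b) + I(a;f|b) - I(c;f|b)`, and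
likewise with `a` and `b` exchanged. Thus `s` further copies of `I(a;c|b) + I(b;c|a)` appear, and
`s(s-1)/2 + s = s(s+1)/2`. The part free of `s` supplies the additional Ingleton term. -/
lemma matusFirst_step (hp : p ∈ stdSimplex ℝ Ω) {s : ℝ} (hs : 0 ≤ s) {a b c d f : Setoid Ω}
    (hf : cmi p (c ⊓ d) f (a ⊓ b) = 0) (h : 0 ≤ matusFirst p s a b c d (c ⊓ f)) :
    0 ≤ matusFirst p (s + 1) a b c d f := by
  obtain ⟨z1, z2, z3, z4⟩ := cmi_inf_eq_zero hp hf
  have y1 := congrArg (s * ·) z1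
  have y2 := congrArg (s * ·) z2
  have y3 := congrArg (s * ·) z3
  have y4 := congrArg (s * ·) z4
  have h1 := cmi_nonneg hp d f a
  have h2 := cmi_nonneg hp c f a
  have h3 := cmi_nonneg hp b f (a ⊓ c ⊓ d)
  have h4 := cmi_nonneg hp c d f
  have h5 := cmi_nonneg hp a b (d ⊓ f)
  have h6 := cmi_nonneg hp d f b
  have h7 := cmi_nonneg hp c f b
  have h8 := cmi_nonneg hp a f (c ⊓ d)
  have h2' := mul_nonneg hs h2
  have h7' := mul_nonneg hs h7
  simp only [matusFirst, ingleton, cmi, inf_top_eq, inf_comm, inf_left_comm] at *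
  linarith

/-- Apart from the Ingleton term, the companion is the second family with `a` and `c` exchanged, so
the induction alternates between the two. Since `I(a;f|bc) = 0`, the sum `I(a;b|f) + I(b;f|a)`
equals `I(b;f|c) + I(b;c|f) + I(a;b|c) + I(b;c|a)` minus `2 I(a;f|c) + 2 I(b;c|af)`. -/
lemma matusCompanion_step (hp : p ∈ stdSimplex ℝ Ω) {s : ℝ} (hs : 0 ≤ s) {a b c d f : Setoid Ω}
    (hf : cmi p (a ⊓ d) f (b ⊓ c) = 0) (h : 0 ≤ matusSecond p s a b c d f) :
    0 ≤ matusCompanion p (s + 1) a b c d f := by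
  obtain ⟨z1, z2, z3, z4⟩ := cmi_inf_eq_zero hp hf
  have y1 := congrArg (s * ·) z1
  have y2 := congrArg (s * ·) z2
  have y3 := congrArg (s * ·) z3
  have y4 := congrArg (s * ·) z4
  have h1 := cmi_nonneg hp d f a
  have h2 := cmi_nonneg hp b c (a ⊓ f)
  have h3 := cmi_nonneg hp b f (a ⊓ c ⊓ d)
  have h4 := cmi_nonneg hp c d f
  have h5 := cmi_nonneg hp a b (d ⊓ f)
  have h6 := cmi_nonneg hp d f b
  have h7 := cmi_nonneg hp a f c
  have h8 := cmi_nonneg hp a f (c ⊓ d)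
  have h9 := cmi_nonneg hp c f (a ⊓ b ⊓ d)
  have h2' := mul_nonneg hs h2
  have h7' := mul_nonneg hs h7
  simp only [matusSecond, matusCompanion, ingleton, cmi, inf_top_eq, inf_comm, inf_left_comm] at *
  linarith

/-- The `s`-dependent part is that of `matusCompanion_step` with `a` and `c` exchanged. -/
lemma matusSecond_step (hp : p ∈ stdSimplex ℝ Ω) {s : ℝ} (hs : 0 ≤ s) {a b c d f : Setoid Ω}
    (hf : cmi p (c ⊓ d) f (a ⊓ b) = 0) (h : 0 ≤ matusCompanion p s a b c d f) :
    0 ≤ matusSecond p (s + 1) a b c d f := by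
  obtain ⟨z1, z2, z3, z4⟩ := cmi_inf_eq_zero hp hf
  have y1 := congrArg (s * ·) z1
  have y2 := congrArg (s * ·) z2
  have y3 := congrArg (s * ·) z3
  have y4 := congrArg (s * ·) z4
  have h1 := cmi_nonneg hp d f a
  have h2 := cmi_nonneg hp a b (c ⊓ f)
  have h3 := cmi_nonneg hp b f (c ⊓ d)
  have h4 := cmi_nonneg hp c d f
  have h5 := cmi_nonneg hp a b (d ⊓ f)
  have h6 := cmi_nonneg hp d f b
  have h7 := cmi_nonneg hp c f a
  have h8 := cmi_nonneg hp a f (b ⊓ c ⊓ d)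
  have h2' := mul_nonneg hs h2
  have h7' := mul_nonneg hs h7
  simp only [matusSecond, matusCompanion, ingleton, cmi, inf_top_eq, inf_comm, inf_left_comm] at *
  linarith

end Matus

/-- `exists_copy` in terms of conditional mutual information. -/
theorem exists_copy_cmi {Ω : Type} [Fintype Ω] {p : Ω → ℝ} (hp : p ∈ stdSimplex ℝ Ω)
    (s y : Setoid Ω) :
    ∃ (Ω' : Type) (_ : Fintype Ω') (p' : Ω' → ℝ) (g : Ω' → Ω) (y' : Setoid Ω'),
      p' ∈ stdSimplex ℝ Ω' ∧
      (∀ u v w : Setoid Ω, cmi p' (u.comap g) (v.comap g) (w.comap g) = cmi p u v w) ∧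
      (∀ u w, s ≤ u ⊓ w → cmi p' (u.comap g) y' (w.comap g) = cmi p u y w ∧
        cmi p' y' (u.comap g) (w.comap g) = cmi p y u w ∧
        cmi p' (u.comap g) (w.comap g) y' = cmi p u w y) ∧
      ∀ u : Setoid Ω, cmi p' (u.comap g) y' (s.comap g) = 0 := by
  obtain ⟨Ω', i, p', g, y', hp', hg, hf, hi⟩ := exists_copy hp s y
  have hc : ∀ u v : Setoid Ω, u.comap g ⊓ v.comap g = (u ⊓ v).comap g := fun _ _ => rfl
  have h0 : ent p' y' = ent p y := by
    have h : ent p' (y' ⊓ ⊤) = ent p (y ⊓ ⊤) := hf ⊤ le_top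
    rwa [inf_top_eq, inf_top_eq] at h
  refine ⟨Ω', i, p', g, y', hp', fun u v w => ?_, fun u w huw => ?_, hi⟩
  · simp only [cmi, hc, hg]
  · have h1 := hf _ huw
    have h2 := hf _ (huw.trans inf_le_left)
    have h3 := hf _ (huw.trans inf_le_right)
    have n1 : ∀ v : Setoid Ω, v.comap g ⊓ y' = y' ⊓ v.comap g := fun v => inf_comm _ _
    have n2 : ∀ v : Setoid Ω, v ⊓ y = y ⊓ v := fun v => inf_comm _ _
    simp only [cmi, n1, n2, inf_assoc, hc, hg, h0, h1, h2, h3, and_self]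

/-- The first Matúš family. -/
theorem matusFirst_nonneg (s : ℕ) : ∀ {Ω : Type} [Fintype Ω] {p : Ω → ℝ}
    (_ : p ∈ stdSimplex ℝ Ω) (a b c d e : Setoid Ω), 0 ≤ matusFirst p s a b c d e := by
  induction s with
  | zero =>
    intro Ω _ p hp a b c d e
    simpa [matusFirst] using cmi_nonneg hp a b e
  | succ s ih =>
    intro Ω _ p hp a b c d e
    obtain ⟨Ω', _, p', g, f, hp', hg, hf, hi⟩ := exists_copy_cmi hp (a ⊓ b) e
    have hi' : cmi p' (c.comap g ⊓ d.comap g) f (a.comap g ⊓ b.comap g) = 0 :=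
      hi (c ⊓ d)
    -- The induction hypothesis is used on the enlarged space, with `c.comap g ⊓ f` as its fifth
    -- variable.
    have := matusFirst_step hp' (Nat.cast_nonneg s) hi' (ih hp' _ _ _ _ _)
    -- In the conclusion `e` occurs only together with `a` and `b`, and the copy `f` has the same
    -- joint entropies with these.
    have e1 := (hf a b le_rfl).1
    have e2 := (hf a b le_rfl).2.2
    have e3 := (hf b a (inf_comm a b).le).1
    have e4 : ∀ u v : Setoid Ω, cmi p' (u.comap g) (v.comap g) ⊤ = cmi p u v ⊤ :=
      fun u v => hg u v ⊤
    simp only [matusFirst, ingleton, e1, e2, e3, hg, e4] at this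
    simpa only [matusFirst, ingleton, Nat.cast_succ] using this

/-- The second Matúš family, together with its companion. -/
theorem matusSecond_nonneg_and (s : ℕ) : ∀ {Ω : Type} [Fintype Ω] {p : Ω → ℝ}
    (_ : p ∈ stdSimplex ℝ Ω) (a b c d e : Setoid Ω),
    0 ≤ matusSecond p s a b c d e ∧ 0 ≤ matusCompanion p s a b c d e := by
  induction s with
  | zero =>
    intro Ω _ p hp a b c d e
    exact ⟨by simpa [matusSecond] using cmi_nonneg hp a e b,
      by simpa [matusCompanion] using cmi_nonneg hp e c b⟩
  | succ s ih =>
    intro Ω _ p hp a b c d e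
    constructor
    · obtain ⟨Ω', _, p', g, f, hp', hg, hf, hi⟩ := exists_copy_cmi hp (a ⊓ b) e
      have hi' : cmi p' (c.comap g ⊓ d.comap g) f (a.comap g ⊓ b.comap g) = 0 :=
        hi (c ⊓ d)
      have := matusSecond_step hp' (Nat.cast_nonneg s) hi' (ih hp' _ _ _ _ _).2
      have e1 := (hf a b le_rfl).1
      have e2 := (hf a b le_rfl).2.2
      have e3 := (hf b a (inf_comm a b).le).1
      have e4 : ∀ u v : Setoid Ω, cmi p' (u.comap g) (v.comap g) ⊤ = cmi p u v ⊤ :=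
        fun u v => hg u v ⊤
      simp only [matusSecond, ingleton, e1, e2, e3, hg, e4] at this
      simpa only [matusSecond, ingleton, Nat.cast_succ] using this
    · obtain ⟨Ω', _, p', g, f, hp', hg, hf, hi⟩ := exists_copy_cmi hp (b ⊓ c) e
      have hi' : cmi p' (a.comap g ⊓ d.comap g) f (b.comap g ⊓ c.comap g) = 0 :=
        hi (a ⊓ d)
      have := matusCompanion_step hp' (Nat.cast_nonneg s) hi' (ih hp' _ _ _ _ _).1
      -- Here `e` occurs only with `b` and `c`, which is why the copy is taken over `b ⊓ c`.
      have e1 := (hf c b (inf_comm b c).le).2.1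
      have e2 := (hf b c le_rfl).2.1
      have e3 := (hf b c le_rfl).2.2
      have e4 : ∀ u v : Setoid Ω, cmi p' (u.comap g) (v.comap g) ⊤ = cmi p u v ⊤ :=
        fun u v => hg u v ⊤
      simp only [matusCompanion, ingleton, e1, e2, e3, hg, e4] at this
      simpa only [matusCompanion, ingleton, Nat.cast_succ] using this

/-! ### Entropy inequalities in the triangle structure. -/

section Triangle

variable {Ω : Type} [Fintype Ω]

/-- Entropic form of the triangle causal structure: the sources `a`, `b`, `c` are independent, and
`x`, `y`, `z` are generated independently from `(b, c)`, `(a, c)`, `(a, b)`. -/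
structure IsTriangle (p : Ω → ℝ) (a b c x y z : Setoid Ω) : Prop where
  sources : ent p (a ⊓ b ⊓ c) = ent p a + ent p b + ent p c
  total : ent p (a ⊓ b ⊓ c ⊓ x ⊓ y ⊓ z) = ent p (a ⊓ b ⊓ c) +
    (ent p (x ⊓ b ⊓ c) - ent p (b ⊓ c)) + (ent p (y ⊓ a ⊓ c) - ent p (a ⊓ c)) +
    (ent p (z ⊓ a ⊓ b) - ent p (a ⊓ b))

namespace IsTriangle

variable {p : Ω → ℝ} {a b c x y z : Setoid Ω}

lemma swap_left (h : IsTriangle p a b c x y z) : IsTriangle p b a c y x z := by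
  obtain ⟨h1, h2⟩ := h
  constructor <;> simp only [inf_comm, inf_left_comm] at * <;> linarith

lemma swap_right (h : IsTriangle p a b c x y z) : IsTriangle p a c b x z y := by
  obtain ⟨h1, h2⟩ := h
  constructor <;> simp only [inf_comm, inf_left_comm] at * <;> linarith

/-- The two fields of `IsTriangle` say that Shannon upper bounds are attained. The slack in these
bounds is a sum of nonnegative conditional mutual informations, which must therefore all vanish. -/
lemma cmi_observed (h : IsTriangle p a b c x y z) (hp : p ∈ stdSimplex ℝ Ω) :
    cmi p x z b = 0 := by
  obtain ⟨E1, E2⟩ := h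
  refine le_antisymm ?_ (cmi_nonneg hp _ _ _)
  have h1 := cmi_nonneg hp c z (b ⊓ x)
  have h2 := cmi_nonneg hp x y (a ⊓ c)
  have h3 := cmi_nonneg hp b y (a ⊓ c ⊓ x)
  have h4 := cmi_nonneg hp a b ⊤
  have h5 := cmi_nonneg hp b c ⊤
  have h6 := cmi_nonneg hp a c (b ⊓ z)
  have h7 := cmi_nonneg hp a x (b ⊓ c ⊓ z)
  have h8 := cmi_nonneg hp y z (a ⊓ b ⊓ c ⊓ x)
  have h0 := ent_top hp
  simp only [cmi, inf_top_eq, inf_comm, inf_left_comm] at *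
  linarith

lemma cmi_source (h : IsTriangle p a b c x y z) (hp : p ∈ stdSimplex ℝ Ω) :
    cmi p y b ⊤ = 0 := by
  obtain ⟨E1, E2⟩ := h
  refine le_antisymm ?_ (cmi_nonneg hp _ _ _)
  have h1 := cmi_nonneg hp a b (c ⊓ y)
  have h2 := cmi_nonneg hp y z (a ⊓ b ⊓ c)
  have h3 := cmi_nonneg hp a c ⊤
  have h4 := cmi_nonneg hp b c y
  have h5 := cmi_nonneg hp x z (b ⊓ c)
  have h6 := cmi_nonneg hp a x (b ⊓ c ⊓ z)
  have h7 := cmi_nonneg hp x y (a ⊓ b ⊓ c ⊓ z)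
  have h8 := cmi_nonneg hp c z (a ⊓ b)
  have h0 := ent_top hp
  simp only [cmi, inf_top_eq, inf_comm, inf_left_comm] at *
  linarith

/-- Since `z` is independent of `c`, `I(y;c) ≤ I(yz;c) = I(y;c|z) ≤ H(y|z)`. -/
lemma cmi_le (h : IsTriangle p a b c x y z) (hp : p ∈ stdSimplex ℝ Ω) :
    cmi p y c ⊤ ≤ ent p (y ⊓ z) - ent p z := by
  obtain ⟨E1, E2⟩ := h
  have h1 := cmi_nonneg hp b y (a ⊓ c ⊓ x)
  have h2 := cmi_nonneg hp a x (b ⊓ c)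
  have h3 := cmi_nonneg hp a c (b ⊓ y ⊓ z)
  have h4 := cmi_nonneg hp x y (a ⊓ c)
  have h5 := cmi_nonneg hp a y (b ⊓ z)
  have h6 := cmi_nonneg hp y z (a ⊓ b ⊓ c ⊓ x)
  have h7 := cmi_nonneg hp x y (a ⊓ b ⊓ c)
  have h8 := cmi_nonneg hp b c z
  -- With a repeated argument this is nonnegativity of conditional entropy.
  have h9 := cmi_nonneg hp y y (a ⊓ b ⊓ c ⊓ x ⊓ z)
  have h10 := cmi_nonneg hp b y (c ⊓ z)
  have h11 := cmi_nonneg hp x z (a ⊓ b ⊓ c ⊓ y)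
  have h12 := cmi_nonneg hp a b ⊤
  have h13 := cmi_nonneg hp c z y
  have h0 := ent_top hp
  simp only [cmi, inf_top_eq, inf_idem, inf_comm, inf_left_comm] at *
  linarith

/-- The right side is `H(x|z) + H(y|z) + I(x;y|z) - I(x;y)`. Adding two instances of `cmi_le` would
give only `H(x|z) + H(y|z)`; the correction is needed when `I(x;y)` exceeds `I(x;y|z)`. -/
lemma cmi_add_le (h : IsTriangle p a b c x y z) (hp : p ∈ stdSimplex ℝ Ω) :
    cmi p y c ⊤ + cmi p x c ⊤ ≤ 2 * ent p (x ⊓ z) + 2 * ent p (y ⊓ z) - 3 * ent p z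
      - ent p (x ⊓ y ⊓ z) - ent p x - ent p y + ent p (x ⊓ y) := by
  obtain ⟨E1, E2⟩ := h
  have h1 := cmi_nonneg hp b c (a ⊓ x ⊓ y ⊓ z)
  have h2 := cmi_nonneg hp y z (a ⊓ b ⊓ c)
  have h3 := cmi_nonneg hp x x (a ⊓ b ⊓ c ⊓ y ⊓ z)
  have h4 := cmi_nonneg hp x y (c ⊓ z)
  have h5 := cmi_nonneg hp b x (a ⊓ z)
  have h6 := cmi_nonneg hp b c (a ⊓ z)
  have h7 := cmi_nonneg hp b c ⊤
  have h8 := cmi_nonneg hp c z x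
  have h9 := cmi_nonneg hp a b (c ⊓ y)
  have h10 := cmi_nonneg hp b y x
  have h11 := cmi_nonneg hp a c ⊤
  have h12 := cmi_nonneg hp b c y
  have h13 := cmi_nonneg hp x z (b ⊓ c)
  have h14 := cmi_nonneg hp a x z
  have h15 := cmi_nonneg hp b y (a ⊓ c)
  have h16 := cmi_nonneg hp a c (b ⊓ z)
  have h17 := cmi_nonneg hp a y (b ⊓ x ⊓ z)
  have h18 := cmi_nonneg hp c z (b ⊓ x)
  have h19 := cmi_nonneg hp a x (b ⊓ c ⊓ z)
  have h20 := cmi_nonneg hp x z (b ⊓ y)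
  have h21 := cmi_nonneg hp c z y
  have h22 := cmi_nonneg hp x y (a ⊓ b ⊓ c ⊓ z)
  have h23 := cmi_nonneg hp a c (x ⊓ y ⊓ z)
  have h24 := cmi_nonneg hp b y z
  have h25 := cmi_nonneg hp y y (a ⊓ b ⊓ c ⊓ x ⊓ z)
  have h26 := cmi_nonneg hp a c z
  have h27 := cmi_nonneg hp a b ⊤
  have h0 := ent_top hp
  simp only [cmi, inf_top_eq, inf_idem, inf_comm, inf_left_comm] at *
  linarith

/-- Taking `y` for both `c` and `e` leaves the source `b` only in the Ingleton terms `I(x;z|b)` and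
`I(y;b)`, which vanish. -/
theorem first_inequality (h : IsTriangle p a b c x y z) (hp : p ∈ stdSimplex ℝ Ω) (s : ℕ) :
    0 ≤ (-(1 / 2 : ℝ) * (s : ℝ) ^ 2 - (3 / 2 : ℝ) * (s : ℝ)) * (ent p x + ent p z)
        - ((s : ℝ) + 1) * ent p y
        + ((1 / 2 : ℝ) * (s : ℝ) ^ 2 + (3 / 2 : ℝ) * (s : ℝ) + 1) * (ent p (x ⊓ y) + ent p (y ⊓ z))
        + (s : ℝ) * ((s : ℝ) + 2) * ent p (x ⊓ z)
        - ((s : ℝ) + 1) ^ 2 * ent p (x ⊓ y ⊓ z) := by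
  have h1 := h.cmi_observed hp
  have h2 := h.cmi_source hp
  have h3 := matusFirst_nonneg s hp x z y b y
  have h0 := ent_top hp
  rw [matusFirst, ingleton, h1, h2] at h3
  simp only [cmi, inf_top_eq, inf_comm, inf_left_comm, h0] at h3 ⊢
  linarith

/-- As `I(x;y|c) = I(z;c) = 0`, the Ingleton term is `I(x;y|z) - I(x;y)`, and `I(y;c|x) = I(y;c) -
I(x;y)`, similarly for `I(x;c|y)`. This leaves `I(y;c) + s(s+1)/2 · I(x;c)`, bounded by one use of
`cmi_add_le` and `s(s+1)/2 - 1` uses of `cmi_le`; the latter count is nonnegative because `s ≥ 1`.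
-/
theorem second_inequality (h : IsTriangle p a b c x y z) (hp : p ∈ stdSimplex ℝ Ω) (s : ℕ)
    (hs : 1 ≤ s) :
    0 ≤ (-(1 / 2 : ℝ) * (s : ℝ) ^ 2 - (3 / 2 : ℝ) * (s : ℝ) - 2)
          * (ent p x + ent p y + ent p z - ent p (x ⊓ y))
        + ((1 / 2 : ℝ) * (s : ℝ) ^ 2 + (3 / 2 : ℝ) * (s : ℝ) + 1) * ent p (x ⊓ z)
        + ((s : ℝ) + 2) * ent p (y ⊓ z)
        - ((s : ℝ) + 1) * ent p (x ⊓ y ⊓ z) := by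
  have h1 := h.swap_right.cmi_observed hp
  have h2 := h.swap_right.cmi_source hp
  have h3 := (matusSecond_nonneg_and s hp y x c z c).1
  have h4 := h.cmi_add_le hp
  have h5 := h.swap_left.cmi_le hp
  have h0 := ent_top hp
  have hs' : (1 : ℝ) ≤ s := by exact_mod_cast hs
  have h6 := mul_nonneg (by nlinarith : 0 ≤ (s : ℝ) * (s + 1) / 2 - 1) (sub_nonneg.2 h5)
  have h7 := congrArg ((s : ℝ) * ·) h1
  have h8 := congrArg ((s : ℝ) ^ 2 * ·) h1
  have h9 := congrArg ((s : ℝ) * ·) h2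
  simp only [matusSecond, ingleton, cmi, inf_top_eq, inf_comm, inf_left_comm, h0] at *
  linarith

/-- Here `c` is both fourth and fifth variable, and `I(x;c) + s · I(y;c)` remains: one use of
`cmi_add_le` and `s - 1` of `cmi_le`. -/
theorem third_inequality (h : IsTriangle p a b c x y z) (hp : p ∈ stdSimplex ℝ Ω) (s : ℕ)
    (hs : 1 ≤ s) :
    0 ≤ (-(1 / 2 : ℝ) * (s : ℝ) ^ 2 - (3 / 2 : ℝ) * (s : ℝ) - 2)
          * (ent p x + ent p z - ent p (x ⊓ y))
        - (2 * (s : ℝ) + 2) * ent p y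
        + ((s : ℝ) ^ 2 + 2) * ent p (x ⊓ z)
        + ((1 / 2 : ℝ) * (s : ℝ) ^ 2 + (3 / 2 : ℝ) * (s : ℝ) + 1) * ent p (y ⊓ z)
        - ((s : ℝ) ^ 2 + 1) * ent p (x ⊓ y ⊓ z) := by
  have h1 := h.swap_right.cmi_observed hp
  have h2 := h.swap_right.cmi_source hp
  have h3 := (matusSecond_nonneg_and s hp x y z c c).1
  have h4 := h.cmi_add_le hp
  have h5 := h.cmi_le hp
  have h0 := ent_top hp
  have hs' : (1 : ℝ) ≤ s := by exact_mod_cast hs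
  have h6 := mul_nonneg (sub_nonneg.2 hs') (sub_nonneg.2 h5)
  have h7 := congrArg ((s : ℝ) * ·) h1
  have h8 := congrArg ((s : ℝ) ^ 2 * ·) h1
  have h9 := congrArg ((s : ℝ) * ·) h2
  simp only [matusSecond, ingleton, cmi, inf_top_eq, inf_comm, inf_left_comm, h0] at *
  linarith

end IsTriangle

end Triangle

/-! ### Continuity of entropy under domination. -/

open Filter Topology

section Limits

variable {α : Type*}

/-- Supplies the summable majorant for dominated convergence; it follows from `log t ≤ t - 1` at `t
= 2 * r / q`. -/
lemma negMulLog_le_of_le_two_mul {q r : ℝ} (hq : 0 ≤ q) (hr : 0 ≤ r) (hr1 : r ≤ 1)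
    (h : q ≤ 2 * r) : Real.negMulLog q ≤ 2 * Real.negMulLog r + 2 * r := by
  have h0 : 0 ≤ Real.negMulLog r := Real.negMulLog_nonneg hr hr1
  rcases hq.eq_or_lt with rfl | hq
  · simp only [Real.negMulLog_zero]; positivity
  have hr' : 0 < r := by linarith
  have e1 : Real.log (2 * r) - Real.log q ≤ 2 * r / q - 1 := by
    rw [← Real.log_div (by positivity) hq.ne']
    exact Real.log_le_sub_one_of_pos (by positivity)
  have e2 : q * (Real.log (2 * r) - Real.log q) ≤ 2 * r - q := by
    calc _ ≤ q * (2 * r / q - 1) := mul_le_mul_of_nonneg_left e1 hq.le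
      _ = 2 * r - q := by field_simp
  have e3 : Real.log r ≤ Real.log (2 * r) := Real.log_le_log hr' (by linarith)
  have e4 : Real.log r ≤ 0 := Real.log_nonpos hr hr1
  simp only [Real.negMulLog] at *
  nlinarith [mul_le_mul_of_nonneg_left e3 hq.le, mul_nonneg (sub_nonneg.2 h) (neg_nonneg.2 e4)]

/-- Entropy converges along probability vectors that are dominated by multiples, tending to one,
of a probability vector with finite entropy. -/
lemma tendsto_entropy {q : ℕ → α → ℝ} {r : α → ℝ} {K h' : ℕ → ℝ} {h : ℝ}
    (hK : Tendsto K atTop (𝓝 1)) (hq : ∀ n x, 0 ≤ q n x) (hq1 : ∀ n, HasSum (q n) 1)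
    (hr : ∀ x, 0 ≤ r x) (hr1 : HasSum r 1) (hqr : ∀ n x, q n x ≤ K n * r x)
    (hh : HasSum (fun x => Real.negMulLog (r x)) h)
    (hh' : ∀ n, HasSum (fun x => Real.negMulLog (q n x)) (h' n)) :
    Tendsto h' atTop (𝓝 h) := by
  have hr1' : ∀ x, r x ≤ 1 := fun x => le_hasSum hr1 x fun y _ => hr y
  have hq1' : ∀ n x, q n x ≤ 1 := fun n x => le_hasSum (hq1 n) x fun y _ => hq n y
  have hpt : ∀ x, Tendsto (fun n => q n x) atTop (𝓝 (r x)) := by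
    intro x
    have h1 : Tendsto (fun n => K n * r x) atTop (𝓝 (r x)) := by
      simpa using hK.mul_const (r x)
    have h2 : Tendsto (fun n => K n * r x - (K n - 1)) atTop (𝓝 (r x)) := by
      simpa using h1.sub (hK.sub_const 1)
    refine tendsto_of_tendsto_of_tendsto_of_le_of_le h2 h1 (fun n => ?_) fun n => hqr n x
    -- The nonnegative differences sum to `K n - 1`, so each is at most that. This turns the
    -- one-sided domination into a lower bound for `q n x`.
    have h3 : HasSum (fun x => K n * r x - q n x) (K n * 1 - 1) := (hr1.mul_left _).sub (hq1 n)
    have h4 := le_hasSum h3 x fun y _ => sub_nonneg.2 (hqr n y)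
    dsimp only
    linarith
  have hlim := tendsto_tsum_of_dominated_convergence (𝓕 := atTop)
    (f := fun n x => Real.negMulLog (q n x)) (g := fun x => Real.negMulLog (r x))
    (bound := fun x => 2 * Real.negMulLog (r x) + 2 * r x)
    ((hh.summable.mul_left 2).add (hr1.summable.mul_left 2))
    (fun x => (Real.continuous_negMulLog.tendsto _).comp (hpt x)) (by
      filter_upwards [hK.eventually (gt_mem_nhds (by norm_num : (1 : ℝ) < 2))] with n hn x
      rw [Real.norm_of_nonneg (Real.negMulLog_nonneg (hq n x) (hq1' n x))]
      exact negMulLog_le_of_le_two_mul (hq n x) (hr x) (hr1' x)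
        ((hqr n x).trans (mul_le_mul_of_nonneg_right hn.le (hr x))))
  rw [hh.tsum_eq] at hlim
  exact hlim.congr fun n => (hh' n).tsum_eq

end Limits

/-! ### Laws of variables on a finite space. -/

section Law

variable {Ω α : Type} [Fintype Ω]

open scoped Classical in
/-- The law of `f` under the weights `p`. -/
noncomputable def law (p : Ω → ℝ) (f : Ω → α) (x : α) : ℝ := ∑ ω, if f ω = x then p ω else 0

variable {p : Ω → ℝ}

lemma law_nonneg (hp : p ∈ stdSimplex ℝ Ω) (f : Ω → α) (x : α) : 0 ≤ law p f x :=
  Finset.sum_nonneg fun ω _ => by split_ifs <;> [exact hp.1 ω; exact le_rfl]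

/-- Change of variables for a function vanishing outside the range of `f`. -/
lemma hasSum_law_mul (p : Ω → ℝ) (f : Ω → α) (F : α → ℝ) :
    HasSum (fun x => law p f x * F x) (∑ ω, p ω * F (f ω)) := by
  classical
  have h : ∀ ω, HasSum (fun x => (if f ω = x then p ω else 0) * F x) (p ω * F (f ω)) := by
    intro ω
    have := hasSum_single (f := fun x => (if f ω = x then p ω else 0) * F x) (f ω)
      (fun x hx => by simp [hx.symm])
    simpa using this
  have := hasSum_sum (s := Finset.univ) fun ω _ => h ω
  simp only [law, Finset.sum_mul]
  convert this

lemma hasSum_law (hp : p ∈ stdSimplex ℝ Ω) (f : Ω → α) : HasSum (law p f) 1 := by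
  simpa [hp.2] using hasSum_law_mul p f fun _ => 1

lemma hasSum_negMulLog_law (p : Ω → ℝ) (f : Ω → α) :
    HasSum (fun x => Real.negMulLog (law p f x)) (ent p (Setoid.ker f)) := by
  have hm : ∀ ω, classMass p (Setoid.ker f) ω = law p f (f ω) := by
    classical
    intro ω
    rw [classMass_def, law]
    refine Finset.sum_congr rfl fun i _ => ?_
    simp [Setoid.ker_def, eq_comm]
  have := (hasSum_law_mul p f fun x => Real.log (law p f x)).neg
  simpa only [ent, hm, Real.negMulLog, neg_mul] using this

/-- Laws push forward. -/
lemma law_comp_le {β : Type} {f : Ω → α} {P : PMF α} {K : ℝ}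
    (h : ∀ x, law p f x ≤ K * (P x).toReal) (g : α → β) (y : β) :
    law p (g ∘ f) y ≤ K * ((P.map g) y).toReal := by
  classical
  have h1 : HasSum (fun x => law p f x * if g x = y then 1 else 0) (law p (g ∘ f) y) := by
    have := hasSum_law_mul p f fun x => if g x = y then 1 else 0
    simp only [mul_ite, mul_one, mul_zero] at this ⊢
    convert this using 1
    simp only [law, Function.comp_apply]
  have h2 : HasSum (fun x => K * ((P x).toReal * if g x = y then 1 else 0))
      (K * ((P.map g) y).toReal) := by
    refine HasSum.mul_left K ?_
    have hs : ∀ x, ((P x).toReal * if g x = y then 1 else 0) =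
        (if y = g x then P x else 0).toReal := by
      intro x
      by_cases hx : g x = y
      · simp [hx]
      · simp [hx, Ne.symm hx]
    simp only [hs]
    rw [PMF.map_apply]
    have hne : (∑' x, if y = g x then P x else 0) ≠ ∞ := by
      refine ne_top_of_le_ne_top ENNReal.one_ne_top ?_
      rw [← P.tsum_coe]
      exact ENNReal.tsum_le_tsum fun x => by split_ifs <;> simp
    rw [ENNReal.tsum_toReal_eq fun x => by split_ifs <;> simp [P.apply_ne_top]]
    exact ENNReal.hasSum_toReal hne
  refine hasSum_le (fun x => ?_) h1 h2
  split_ifs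
  · simpa using h x
  · simp

end Law

/-! ### Finite triangle models. -/

section Kernels

open Setoid

lemma isTriangle_of_cmi {Ω : Type} [Fintype Ω] {p : Ω → ℝ} (hp : p ∈ stdSimplex ℝ Ω)
    {a b c x y z : Setoid Ω} (h1 : cmi p a b ⊤ = 0) (h2 : cmi p (a ⊓ b) c ⊤ = 0)
    (h3 : cmi p (a ⊓ b ⊓ c) x (b ⊓ c) = 0) (h4 : cmi p (a ⊓ b ⊓ c ⊓ x) y (a ⊓ c) = 0)
    (h5 : cmi p (a ⊓ b ⊓ c ⊓ x ⊓ y) z (a ⊓ b) = 0) : IsTriangle p a b c x y z := by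
  have h0 := ent_top hp
  constructor <;>
  · simp only [cmi, inf_top_eq, inf_comm, inf_left_comm, inf_idem, inf_left_idem] at *
    linarith

lemma ker_eq_inf_ker {Ω U V : Type} (f : Ω → U × V) :
    ker f = (ker fun w => (f w).1) ⊓ (ker fun w => (f w).2) :=
  Setoid.ext fun _ _ => Prod.ext_iff

/-- The distribution generated by independent sources and kernels. -/
noncomputable def triangleWeights {A B C X Y Z : Type} (pA : A → ℝ) (pB : B → ℝ) (pC : C → ℝ)
    (kX : B → C → X → ℝ) (kY : A → C → Y → ℝ) (kZ : A → B → Z → ℝ) :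
    ((((A × B) × C) × X) × Y) × Z → ℝ :=
  extend (extend (extend (extend (extend pA fun _ => pB) fun _ => pC) fun w => kX w.1.2 w.2)
    fun w => kY w.1.1.1 w.1.2) fun w => kZ w.1.1.1.1 w.1.1.1.2

/-- The distribution generated by independent sources and kernels has the triangle structure. -/
theorem isTriangle_of_kernels {A B C X Y Z : Type} [Fintype A] [Fintype B] [Fintype C]
    [Fintype X] [Fintype Y] [Fintype Z] {pA : A → ℝ} {pB : B → ℝ} {pC : C → ℝ}
    {kX : B → C → X → ℝ} {kY : A → C → Y → ℝ} {kZ : A → B → Z → ℝ}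
    (hA : pA ∈ stdSimplex ℝ A) (hB : pB ∈ stdSimplex ℝ B) (hC : pC ∈ stdSimplex ℝ C)
    (hX : ∀ b c, kX b c ∈ stdSimplex ℝ X) (hY : ∀ a c, kY a c ∈ stdSimplex ℝ Y)
    (hZ : ∀ a b, kZ a b ∈ stdSimplex ℝ Z) :
    triangleWeights pA pB pC kX kY kZ ∈ stdSimplex ℝ _ ∧
    IsTriangle (triangleWeights pA pB pC kX kY kZ) (ker fun w => w.1.1.1.1.1)
      (ker fun w => w.1.1.1.1.2) (ker fun w => w.1.1.1.2)
      (ker fun w => w.1.1.2) (ker fun w => w.1.2) (ker fun w => w.2) := by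
  classical
  unfold triangleWeights
  have h2 := extend_mem_stdSimplex hA fun _ => hB
  have l3 := cmi_comap Prod.fst (sum_extend_fst (extend pA fun _ => pB) fun _ => hC)
  -- The finest partitions `⊥` pull back to the kernels of the coordinate projections, and `t = ⊤`
  -- expresses a source drawn independently of the past.
  have i2 := cmi_extend hA (fun _ => hB) ⊤ (fun _ _ _ => rfl) ⊥ ⊥
  have i3 := cmi_extend h2 (fun _ => hC) ⊤ (fun _ _ _ => rfl) ⊥ ⊥
  have h3 := extend_mem_stdSimplex h2 fun _ => hC
  generalize extend pA (fun _ => pB) = p2 at *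
  have hkX : ∀ w : (A × B) × C, kX w.1.2 w.2 ∈ stdSimplex ℝ X := fun w => hX _ _
  have i4 := cmi_extend h3 hkX (ker fun w => (w.1.2, w.2)) (fun w w' h => by
    have h' := Prod.mk.inj h; simp only [h'.1, h'.2]) ⊥ ⊥
  have l4 := cmi_comap Prod.fst (sum_extend_fst (extend p2 fun _ => pC) hkX)
  have h4 := extend_mem_stdSimplex h3 hkX
  generalize extend p2 (fun _ => pC) = p3 at *
  have hkY : ∀ w : ((A × B) × C) × X, kY w.1.1.1 w.1.2 ∈ stdSimplex ℝ Y := fun w => hY _ _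
  have i5 := cmi_extend h4 hkY (ker fun w => (w.1.1.1, w.1.2)) (fun w w' h => by
    have h' := Prod.mk.inj h; simp only [h'.1, h'.2]) ⊥ ⊥
  have l5 := cmi_comap Prod.fst (sum_extend_fst (extend p3 fun w => kX w.1.2 w.2) hkY)
  have h5 := extend_mem_stdSimplex h4 hkY
  generalize (extend p3 fun w => kX w.1.2 w.2) = p4 at *
  have hkZ : ∀ w : (((A × B) × C) × X) × Y, kZ w.1.1.1.1 w.1.1.1.2 ∈ stdSimplex ℝ Z :=
    fun w => hZ _ _
  have i6 := cmi_extend h5 hkZ (ker fun w => (w.1.1.1.1, w.1.1.1.2)) (fun w w' h => by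
    have h' := Prod.mk.inj h; simp only [h'.1, h'.2]) ⊥ ⊥
  have l6 := cmi_comap Prod.fst (sum_extend_fst (extend p4 fun w => kY w.1.1.1 w.1.2) hkZ)
  have h6 := extend_mem_stdSimplex h5 hkZ
  generalize (extend p4 fun w => kY w.1.1.1 w.1.2) = p5 at *
  generalize (extend p5 fun w => kZ w.1.1.1.1 w.1.1.1.2) = p at *
  -- Each independence is transported from the stage where its variable is created to the final
  -- space.
  rw [← l3, ← l4, ← l5, ← l6] at i2
  rw [← l4, ← l5, ← l6] at i3
  rw [← l5, ← l6] at i4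
  rw [← l6] at i5
  have j2 : cmi p (ker fun w => w.1.1.1.1.1) (ker fun w => w.1.1.1.1.2) ⊤ = 0 := i2
  have j3 : cmi p (ker fun w => w.1.1.1.1) (ker fun w => w.1.1.1.2) ⊤ = 0 := i3
  have j4 : cmi p (ker fun w => w.1.1.1) (ker fun w => w.1.1.2)
      (ker fun w => (w.1.1.1.1.2, w.1.1.1.2)) = 0 := i4
  have j5 : cmi p (ker fun w => w.1.1) (ker fun w => w.1.2)
      (ker fun w => (w.1.1.1.1.1, w.1.1.1.2)) = 0 := i5
  have j6 : cmi p (ker fun w => w.1) (ker fun w => w.2)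
      (ker fun w => (w.1.1.1.1.1, w.1.1.1.1.2)) = 0 := i6
  refine ⟨h6, isTriangle_of_cmi h6 j2 ?_ ?_ ?_ ?_⟩
  · simpa only [ker_eq_inf_ker] using j3
  · simpa only [ker_eq_inf_ker] using j4
  · simpa only [ker_eq_inf_ker] using j5
  · simpa only [ker_eq_inf_ker] using j6

end Kernels

/-! ### Approximation by finite models. -/

section Truncation

lemma hasSum_toReal_pmf {α : Type} (P : PMF α) : HasSum (fun a => (P a).toReal) 1 := by
  have h : (∑' a, P a) ≠ ∞ := P.tsum_coe ▸ ENNReal.one_ne_top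
  have := ENNReal.hasSum_toReal h
  rwa [← ENNReal.tsum_toReal_eq fun a => P.apply_ne_top a, P.tsum_coe, ENNReal.toReal_one] at this

/-- Conditioning on a large finite set changes the probabilities by a factor close to one. -/
lemma exists_truncation {α : Type} (P : PMF α) {r : ℝ} (hr : 1 < r) :
    ∃ F : Finset α, ∀ F' : Finset α, F ⊆ F' →
      ∃ q ∈ stdSimplex ℝ F', ∀ a, q a ≤ r * (P a).toReal := by
  have h0 : 0 < r := one_pos.trans hr
  obtain ⟨F, hF⟩ := eventually_atTop.1
    ((hasSum_toReal_pmf P).eventually (lt_mem_nhds (inv_lt_one_of_one_lt₀ hr)))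
  refine ⟨F, fun F' hF' => ?_⟩
  have hm := hF F' hF'
  have hm0 := (inv_pos.2 h0).trans hm
  refine ⟨fun a => (P a).toReal / ∑ a ∈ F', (P a).toReal, ⟨fun a => by positivity, ?_⟩,
    fun a => ?_⟩
  · rw [← Finset.sum_div, Finset.sum_coe_sort F' fun a => (P a).toReal, div_self hm0.ne']
  · dsimp only
    rw [div_eq_inv_mul]
    exact mul_le_mul_of_nonneg_right (inv_le_of_inv_le₀ h0 hm.le) ENNReal.toReal_nonneg

/-- Once the sources are finite there are only finitely many rows, so the union of their truncation
sets is a common finite alphabet. -/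
lemma exists_truncation_kernel {B C X : Type} [Fintype B] [Fintype C] (P : B → C → PMF X) {r : ℝ}
    (hr : 1 < r) :
    ∃ (F : Finset X) (q : B → C → F → ℝ),
      (∀ b c, q b c ∈ stdSimplex ℝ F) ∧ ∀ b c a, q b c a ≤ r * (P b c a).toReal := by
  classical
  choose F hF using fun b c => exists_truncation (P b c) hr
  let G : Finset X := Finset.univ.biUnion fun b => Finset.univ.biUnion fun c => F b c
  have hG : ∀ b c, F b c ⊆ G := fun b c =>
    (Finset.subset_biUnion_of_mem (fun c => F b c) (Finset.mem_univ c)).trans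
      (Finset.subset_biUnion_of_mem (fun b => Finset.univ.biUnion fun c => F b c)
        (Finset.mem_univ b))
  choose q hq hq' using fun b c => hF b c G (hG b c)
  exact ⟨G, q, hq, hq'⟩

/-- A distribution compatible with the triangle is approximated by distributions that are generated
by the triangle from finite sources and alphabets. -/
theorem exists_finite_approximation {E : Fin 3 → Type} {P : PMF (∀ i, E i)}
    (hP : P ∈ triangleDistributions E) {r : ℝ} (hr : 1 < r) :
    ∃ (Ω : Type) (_ : Fintype Ω) (p : Ω → ℝ) (a b c : Setoid Ω) (W : Ω → ∀ i, E i),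
      p ∈ stdSimplex ℝ Ω ∧
      IsTriangle p a b c (Setoid.ker fun ω => W ω 0) (Setoid.ker fun ω => W ω 1)
        (Setoid.ker fun ω => W ω 2) ∧
      ∀ x, law p W x ≤ r ^ 6 * (P x).toReal := by
  classical
  obtain ⟨A, B, C, pA, pB, pC, pX, pY, pZ, hP⟩ := hP
  have h0 : 0 ≤ r := by linarith
  obtain ⟨FA, hFA⟩ := exists_truncation pA hr
  obtain ⟨qA, hA, hA'⟩ := hFA FA subset_rfl
  obtain ⟨FB, hFB⟩ := exists_truncation pB hr
  obtain ⟨qB, hB, hB'⟩ := hFB FB subset_rfl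
  obtain ⟨FC, hFC⟩ := exists_truncation pC hr
  obtain ⟨qC, hC, hC'⟩ := hFC FC subset_rfl
  obtain ⟨FX, qX, hX, hX'⟩ := exists_truncation_kernel (fun (b : FB) (c : FC) => pX b c) hr
  obtain ⟨FY, qY, hY, hY'⟩ := exists_truncation_kernel (fun (a : FA) (c : FC) => pY a c) hr
  obtain ⟨FZ, qZ, hZ, hZ'⟩ := exists_truncation_kernel (fun (a : FA) (b : FB) => pZ a b) hr
  obtain ⟨hp, hT⟩ := isTriangle_of_kernels hA hB hC hX hY hZ
  let W : ((((FA × FB) × FC) × FX) × FY) × FZ → ∀ i, E i := fun w i =>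
    match i with
    | 0 => w.1.1.2
    | 1 => w.1.2
    | 2 => w.2
  have e0 : (Setoid.ker fun w => W w 0) = Setoid.ker fun w => w.1.1.2 :=
    Setoid.ext fun _ _ => Subtype.coe_inj
  have e1 : (Setoid.ker fun w => W w 1) = Setoid.ker fun w => w.1.2 :=
    Setoid.ext fun _ _ => Subtype.coe_inj
  have e2 : (Setoid.ker fun w => W w 2) = Setoid.ker fun w => w.2 :=
    Setoid.ext fun _ _ => Subtype.coe_inj
  rw [← e0, ← e1, ← e2] at hT
  refine ⟨_, inferInstance, _, _, _, _, W, hp, hT, fun x => ?_⟩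
  let T : A × B × C → ℝ≥0∞ := fun t => pA t.1 * pB t.2.1 * pC t.2.2 * pX t.2.1 t.2.2 (x 0) *
    pY t.1 t.2.2 (x 1) * pZ t.1 t.2.1 (x 2)
  have hPT : P x = ∑' t, T t := by
    rw [hP]
    exact ((ENNReal.tsum_prod (f := fun a t => T (a, t))).trans
      (tsum_congr fun a => ENNReal.tsum_prod (f := fun b c => T (a, b, c)))).symm
  -- On the fibre over `x` the observed coordinates are fixed, so a point is determined by its
  -- source values, and the finite sum is part of the series for `P x`.
  let f : {w // W w = x} → A × B × C := fun w =>
    (w.1.1.1.1.1.1, w.1.1.1.1.1.2, w.1.1.1.1.2)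
  have hf : Function.Injective f := by
    rintro ⟨⟨⟨⟨⟨⟨a, b⟩, c⟩, x0⟩, x1⟩, x2⟩, h⟩ ⟨⟨⟨⟨⟨⟨a', b'⟩, c'⟩, x0'⟩, x1'⟩, x2'⟩, h'⟩ hff
    simp only [f, Prod.mk.injEq, Subtype.coe_inj] at hff
    have h := h.trans h'.symm
    have k0 : x0 = x0' := Subtype.ext (congrFun h 0)
    have k1 : x1 = x1' := Subtype.ext (congrFun h 1)
    have k2 : x2 = x2' := Subtype.ext (congrFun h 2)
    obtain ⟨rfl, rfl, rfl⟩ := hff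
    subst k0 k1 k2
    rfl
  have hle : ∑ w, T (f w) ≤ P x := by
    rw [hPT, ← tsum_fintype (L := .unconditional _)]
    exact ENNReal.tsum_comp_le_tsum_of_injective hf T
  have hTtop : ∀ w, T (f w) ≠ ∞ := fun w =>
    ne_top_of_le_ne_top (P.apply_ne_top x)
      ((Finset.single_le_sum (fun _ _ => zero_le) (Finset.mem_univ w)).trans hle)
  calc law (triangleWeights qA qB qC qX qY qZ) W x
      = ∑ w : {w // W w = x}, triangleWeights qA qB qC qX qY qZ w := by
        rw [law, ← Finset.sum_subtype (Finset.univ.filter fun w => W w = x) (by simp),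
          Finset.sum_filter]
        exact Finset.sum_congr rfl fun w _ => by congr
    -- Three sources and three kernels each cost one factor `r`.
    _ ≤ ∑ w : {w // W w = x}, r ^ 6 * (T (f w)).toReal := by
        refine Finset.sum_le_sum fun w _ => ?_
        obtain ⟨⟨⟨⟨⟨⟨a, b⟩, c⟩, x0⟩, x1⟩, x2⟩, h⟩ := w
        have k0 : (x0 : E 0) = x 0 := congrFun h 0
        have k1 : (x1 : E 1) = x 1 := congrFun h 1
        have k2 : (x2 : E 2) = x 2 := congrFun h 2
        simp only [triangleWeights, extend, f, T, ENNReal.toReal_mul, ← k0, ← k1, ← k2]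
        have n1 := hA.1 a
        have n2 := hB.1 b
        have n3 := hC.1 c
        have n4 := (hX b c).1 x0
        have n5 := (hY a c).1 x1
        have n6 := (hZ a b).1 x2
        calc qA a * qB b * qC c * qX b c x0 * qY a c x1 * qZ a b x2
            ≤ (r * (pA a).toReal) * (r * (pB b).toReal) * (r * (pC c).toReal) *
              (r * (pX b c x0).toReal) * (r * (pY a c x1).toReal) * (r * (pZ a b x2).toReal) := by
              gcongr
              exacts [hA' a, hB' b, hC' c, hX' b c x0, hY' a c x1, hZ' a b x2]
          _ = _ := by ring
    _ = r ^ 6 * (∑ w, T (f w)).toReal := by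
        rw [← Finset.mul_sum, ENNReal.toReal_sum fun w _ => hTtop w]
    _ ≤ r ^ 6 * (P x).toReal :=
        mul_le_mul_of_nonneg_left (ENNReal.toReal_mono (P.apply_ne_top x) hle) (by positivity)

end Truncation

/-! ### Passage to the limit. -/

section EntropyVectors

/-- The entropy vector, in bits, of three variables on a finite probability space. -/
noncomputable def entropyVector {Ω : Type} [Fintype Ω] {E : Fin 3 → Type} (p : Ω → ℝ)
    (W : Ω → ∀ i, E i) : EntropySpace :=
  fun S => ent p (Setoid.ker (S.1.restrict ∘ W)) / Real.log 2

lemma entropyVector_H {Ω : Type} [Fintype Ω] {E : Fin 3 → Type} (p : Ω → ℝ) (W : Ω → ∀ i, E i)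
    {S : Finset (Fin 3)} (hS : S.Nonempty) {r : Setoid Ω}
    (hr : ∀ ω ω', r ω ω' ↔ ∀ i ∈ S, W ω i = W ω' i) :
    (entropyVector p W).H S = ent p r / Real.log 2 := by
  have : Setoid.ker (S.restrict ∘ W) = r := by
    refine Setoid.ext fun ω ω' => ?_
    rw [hr, Setoid.ker_def]
    simp [funext_iff]
  rw [EntropySpace.H, dif_pos hS, entropyVector, this]

lemma continuous_H (S : Finset (Fin 3)) : Continuous fun v : EntropySpace => v.H S := by
  unfold EntropySpace.H
  split_ifs
  · exact continuous_apply _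
  · exact continuous_const

/-- Entropy vectors of triangle distributions are limits of those with finite sources and
alphabets. -/
theorem exists_tendsto_entropyVector {v : EntropySpace} (hv : v ∈ triangleEntropyVectors) :
    ∃ u : ℕ → EntropySpace, Tendsto u atTop (𝓝 v) ∧
      ∀ n, ∃ (Ω : Type) (_ : Fintype Ω) (E : Fin 3 → Type) (p : Ω → ℝ) (a b c : Setoid Ω)
        (W : Ω → ∀ i, E i), p ∈ stdSimplex ℝ Ω ∧
        IsTriangle p a b c (Setoid.ker fun ω => W ω 0) (Setoid.ker fun ω => W ω 1)
          (Setoid.ker fun ω => W ω 2) ∧ u n = entropyVector p W := by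
  obtain ⟨E, P, hP, hv⟩ := hv
  have hr : ∀ n : ℕ, (1 : ℝ) < 1 + 1 / ((n : ℝ) + 1) := fun n => by
    have : (0 : ℝ) < 1 / ((n : ℝ) + 1) := by positivity
    linarith
  choose Ω i p a b c W hp hT hle using fun n => exists_finite_approximation hP (hr n)
  refine ⟨fun n => entropyVector (p n) (W n), tendsto_pi_nhds.2 fun S => ?_,
    fun n => ⟨Ω n, i n, E, p n, a n, b n, c n, W n, hp n, hT n, rfl⟩⟩
  have hlog : Real.log 2 ≠ 0 := (Real.log_pos one_lt_two).ne'
  have hK : Tendsto (fun n : ℕ => (1 + 1 / ((n : ℝ) + 1)) ^ 6) atTop (𝓝 1) := by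
    simpa using (tendsto_one_div_add_atTop_nhds_zero_nat.const_add (1 : ℝ)).pow 6
  have hS : HasSum (fun x => Real.negMulLog ((marginal P S) x).toReal) (v S * Real.log 2) := by
    refine ((hv S).mul_right (Real.log 2)).congr_fun fun x => ?_
    simp only [Real.negMulLog, Real.logb]
    field_simp
  have := tendsto_entropy hK (fun n x => law_nonneg (hp n) (S.1.restrict ∘ W n) x)
    (fun n => hasSum_law (hp n) _) (fun x => ENNReal.toReal_nonneg)
    (hasSum_toReal_pmf (marginal P S)) (fun n x => law_comp_le (hle n) _ x) hS
    (fun n => hasSum_negMulLog_law (p n) _)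
  simpa [entropyVector, hlog] using this.div_const (Real.log 2)

end EntropyVectors

/-- The two swaps generate all permutations of the observed variables, with the sources relabelled
accordingly. -/
lemma IsTriangle.permute {Ω : Type} [Fintype Ω] {p : Ω → ℝ} {a b c : Setoid Ω}
    {t : Fin 3 → Setoid Ω} (h : IsTriangle p a b c (t 0) (t 1) (t 2)) {X Y Z : Fin 3}
    (hXY : X ≠ Y) (hXZ : X ≠ Z) (hYZ : Y ≠ Z) :
    ∃ a' b' c', IsTriangle p a' b' c' (t X) (t Y) (t Z) := by
  fin_cases X <;> fin_cases Y <;> fin_cases Z <;> first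
    | exact absurd rfl hXY
    | exact absurd rfl hXZ
    | exact absurd rfl hYZ
    | exact ⟨_, _, _, h⟩
    | exact ⟨_, _, _, h.swap_left⟩
    | exact ⟨_, _, _, h.swap_right⟩
    | exact ⟨_, _, _, h.swap_left.swap_right⟩
    | exact ⟨_, _, _, h.swap_right.swap_left⟩
    | exact ⟨_, _, _, h.swap_left.swap_right.swap_left⟩

theorem proposition3 (v : EntropySpace) (hv : v ∈ triangleEntropyVectors)
    (s : ℕ) (hs : 1 ≤ s)
    (X Y Z : Fin 3) (hXY : X ≠ Y) (hXZ : X ≠ Z) (hYZ : Y ≠ Z) :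
    0 ≤ (-(1 / 2 : ℝ) * (s : ℝ) ^ 2 - (3 / 2 : ℝ) * (s : ℝ)) * (v.H {X} + v.H {Z})
        - ((s : ℝ) + 1) * v.H {Y}
        + ((1 / 2 : ℝ) * (s : ℝ) ^ 2 + (3 / 2 : ℝ) * (s : ℝ) + 1) * (v.H {X, Y} + v.H {Y, Z})
        + (s : ℝ) * ((s : ℝ) + 2) * v.H {X, Z}
        - ((s : ℝ) + 1) ^ 2 * v.H {X, Y, Z}
    ∧ 0 ≤ (-(1 / 2 : ℝ) * (s : ℝ) ^ 2 - (3 / 2 : ℝ) * (s : ℝ) - 2)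
          * (v.H {X} + v.H {Y} + v.H {Z} - v.H {X, Y})
        + ((1 / 2 : ℝ) * (s : ℝ) ^ 2 + (3 / 2 : ℝ) * (s : ℝ) + 1) * v.H {X, Z}
        + ((s : ℝ) + 2) * v.H {Y, Z}
        - ((s : ℝ) + 1) * v.H {X, Y, Z}
    ∧ 0 ≤ (-(1 / 2 : ℝ) * (s : ℝ) ^ 2 - (3 / 2 : ℝ) * (s : ℝ) - 2)
          * (v.H {X} + v.H {Z} - v.H {X, Y})
        - (2 * (s : ℝ) + 2) * v.H {Y}
        + ((s : ℝ) ^ 2 + 2) * v.H {X, Z}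
        + ((1 / 2 : ℝ) * (s : ℝ) ^ 2 + (3 / 2 : ℝ) * (s : ℝ) + 1) * v.H {Y, Z}
        - ((s : ℝ) ^ 2 + 1) * v.H {X, Y, Z} := by
  obtain ⟨u, hu, hfin⟩ := exists_tendsto_entropyVector hv
  have hH : ∀ S, Tendsto (fun n => (u n).H S) atTop (𝓝 (v.H S)) := fun S =>
    ((continuous_H S).tendsto v).comp hu
  have hc : ∀ k : ℝ, Tendsto (fun _ : ℕ => k) atTop (𝓝 k) := fun k => tendsto_const_nhds
  -- Each expression is a fixed linear combination of components, so its value at `v` is a limit of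
  -- values at finite models. Passing from nats to bits only divides by `log 2 > 0`.
  refine ⟨ge_of_tendsto' ((((((hc _).mul ((hH _).add (hH _))).sub ((hc _).mul (hH _))).add
      ((hc _).mul ((hH _).add (hH _)))).add ((hc _).mul (hH _))).sub ((hc _).mul (hH _)))
      fun n => ?_,
    ge_of_tendsto' (((((hc _).mul ((((hH _).add (hH _)).add (hH _)).sub (hH _))).add
      ((hc _).mul (hH _))).add ((hc _).mul (hH _))).sub ((hc _).mul (hH _))) fun n => ?_,
    ge_of_tendsto' ((((((hc _).mul (((hH _).add (hH _)).sub (hH _))).sub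
      ((hc _).mul (hH _))).add ((hc _).mul (hH _))).add ((hc _).mul (hH _))).sub
      ((hc _).mul (hH _))) fun n => ?_⟩
  all_goals
    obtain ⟨Ω, _, E, p, a, b, c, W, hp, hT, hn⟩ := hfin n
    obtain ⟨a', b', c', hT⟩ :=
      IsTriangle.permute (t := fun i => Setoid.ker fun ω => W ω i) hT hXY hXZ hYZ
    have hlog : 0 < Real.log 2 := Real.log_pos one_lt_two
    have h1 : ∀ i, (u n).H {i} = ent p (Setoid.ker fun ω => W ω i) / Real.log 2 := fun i =>
      hn ▸ entropyVector_H p W (Finset.singleton_nonempty i) fun ω ω' => by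
        simp [Setoid.ker_def]
    have h2 : ∀ i j, (u n).H {i, j} =
        ent p ((Setoid.ker fun ω => W ω i) ⊓ Setoid.ker fun ω => W ω j) / Real.log 2 := fun i j =>
      hn ▸ entropyVector_H p W (Finset.insert_nonempty _ _) fun ω ω' => by
        simp only [Finset.mem_insert, Finset.mem_singleton, forall_eq_or_imp, forall_eq]
        exact Iff.rfl
    have h3 : (u n).H {X, Y, Z} = ent p ((Setoid.ker fun ω => W ω X) ⊓
        (Setoid.ker fun ω => W ω Y) ⊓ Setoid.ker fun ω => W ω Z) / Real.log 2 :=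
      hn ▸ entropyVector_H p W (Finset.insert_nonempty _ _) fun ω ω' => by
        simp only [Finset.mem_insert, Finset.mem_singleton, forall_eq_or_imp, forall_eq]
        exact and_assoc
    rw [h1, h1, h1, h2, h2, h2, h3]
  · exact (div_nonneg (hT.first_inequality hp s) hlog.le).trans_eq (by ring)
  · exact (div_nonneg (hT.second_inequality hp s hs) hlog.le).trans_eq (by ring)
  · exact (div_nonneg (hT.third_inequality hp s hs) hlog.le).trans_eq (by ring)
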